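/- Let $X=\{X(n):n\ge 0\}$ be a Markov chain on a state space $(\mathsf X,\mathcal B)$ with countably generated $\sigma$-algebra $\mathcal B$, with transition kernel $P$ and $n$-step kernels $P^n$. Suppose: (i) the chain is reversible with respect to a probability measure $\pi$, that is, $\pi(dx)P(x,dy)=\pi(dy)P(y,dx)$; (ii) the chain is $\psi$-irreducible and aperiodic, that is, $\psi$ is a nonzero $\sigma$-finite measure such that, for every $A\in\mathcal B$ with $\psi(A)>0$ and every $x\in\mathsf X$, $P^n(x,A)>0$ for all sufficiently large $n$, and $\psi$ is maximal in the sense that every other $\sigma$-finite measure with this property is absolutely continuous with respect to $\psi$. View $P$, $PF(x)=\int F(y)\,P(x,dy)$, as a bounded linear operator on the complex Hilbert space $L_2=L_2(\pi)$, and let $\mathcal S_2$ be the set of nonzero $\lambda\in\mathbb C$ for which $\lambda I-P$ has no bounded inverse on $L_2$. Suppose that $P$ admits a spectral gap in $L_2$: there is $\varepsilon_0>0$ such that $\mathcal S_2\cap\{z:|z|\ge 1-\varepsilon_0\}$ is finite and contains only poles of finite multiplicity (isolated points of the spectrum whose spectral projection $\frac{1}{2\pi i}\oint (zI-P)^{-1}dz$,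 taken over a small circle around the point, has finite rank). Suppose also that $$\delta_2:=1-\sup\{|\lambda| : \lambda\in\mathcal S_2,\ \lambda\ne 1\}>0,\qquad \sup\emptyset:=0.$$ For a signed measure $\nu$ on $(\mathsf X,\mathcal B)$ let $\|\nu\|_{\rm TV}:=\sup_{A\in\mathcal B}|\nu(A)|$, and let $\|\nu\|_2$ be the $L_2(\pi)$-norm of the density $d\nu/d\pi$ if the density exists, and $\|\nu\|_2:=\infty$ otherwise. Then for every initial distribution (probability measure) $\mu$ and every $n\ge 1$, $$\|\mu P^n-\pi\|_{\rm TV}\le \tfrac12\,\|\mu-\pi\|_2\,(1-\delta_2)^n ,$$ where nothing is claimed if the right-hand side is the indeterminate product $\infty\cdot 0$ (that is, if $\|\mu-\pi\|_2=\infty$ and $\delta_2=1$). -/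

import Mathlib

open MeasureTheory ProbabilityTheory Filter
open scoped ENNReal

namespace MarkovL2

noncomputable section

/-- The `n`-step kernel of a Markov chain is a Markov kernel. -/
instance isMarkovKernel_pow {X : Type*} [MeasurableSpace X] (P : Kernel X X) [IsMarkovKernel P]
    (n : ℕ) : IsMarkovKernel (P ^ n) := by
  induction n with
  | zero => rw [pow_zero]; exact inferInstanceAs (IsMarkovKernel Kernel.id)
  | succ n ih => rw [pow_succ]; exact inferInstanceAs (IsMarkovKernel ((P ^ n) ∘ₖ P))

/-! ### Irreducibility and aperiodicity -/

/-- Every set charged by `ψ` is charged by `P ^ n` for all large `n`, from every initial state. -/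
def EventuallyCharges {X : Type*} [MeasurableSpace X] (P : Kernel X X) (ψ : Measure X) : Prop :=
  ∀ A : Set X, MeasurableSet A → 0 < ψ A → ∀ x : X, ∀ᶠ n : ℕ in atTop, 0 < (P ^ n) x A

/-- The chain with transition kernel `P` is `ψ`-irreducible and aperiodic, with `ψ` a (nonzero,
σ-finite) maximal irreducibility measure. -/
structure IsPsiIrreducibleAperiodic {X : Type*} [MeasurableSpace X] (P : Kernel X X)
    (ψ : Measure X) : Prop where
  sigmaFinite : SigmaFinite ψ
  ne_zero : ψ ≠ 0
  charges : EventuallyCharges P ψ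
  maximal : ∀ ψ' : Measure X, SigmaFinite ψ' → EventuallyCharges P ψ' → ψ' ≪ ψ

/-! ### The transition kernel as an operator on complex `L²(π)` -/

section Operator

variable {X : Type*} [MeasurableSpace X] {P : Kernel X X} [IsMarkovKernel P] {π : Measure X}
  [IsProbabilityMeasure π]

lemma ae_ae_of_ae (h : P.Invariant π) {p : X → Prop} (hp : ∀ᵐ x ∂π, p x) :
    ∀ᵐ x ∂π, ∀ᵐ y ∂(P x), p y := by
  have hp' : ∀ᵐ x ∂(π.bind P), p x := by rwa [h.def]
  exact Measure.ae_ae_of_ae_bind P.measurable.aemeasurable hp'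

lemma integral_ae_congr (h : P.Invariant π) {f g : X → ℂ} (hfg : f =ᵐ[π] g) :
    (fun x => ∫ y, f y ∂(P x)) =ᵐ[π] fun x => ∫ y, g y ∂(P x) := by
  filter_upwards [ae_ae_of_ae h hfg] with x hx using integral_congr_ae hx

lemma lintegral_lintegral_enorm_sq (h : P.Invariant π) {f : X → ℂ} (hf : StronglyMeasurable f) :
    ∫⁻ x, ∫⁻ y, ‖f y‖ₑ ^ (2 : ℝ) ∂(P x) ∂π = ∫⁻ x, ‖f x‖ₑ ^ (2 : ℝ) ∂π := by
  rw [← Measure.lintegral_bind P.measurable.aemeasurable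
    (by have := hf.measurable; fun_prop), h.def]

lemma enorm_integral_sq_le {f : X → ℂ} (hf : StronglyMeasurable f) (x : X) :
    ‖∫ y, f y ∂(P x)‖ₑ ^ (2 : ℝ) ≤ ∫⁻ y, ‖f y‖ₑ ^ (2 : ℝ) ∂(P x) := by
  have h1 : ‖∫ y, f y ∂(P x)‖ₑ ≤ eLpNorm f 2 (P x) :=
    (enorm_integral_le_lintegral_enorm f).trans <| by
      rw [← eLpNorm_one_eq_lintegral_enorm]
      exact eLpNorm_le_eLpNorm_of_exponent_le (by norm_num) hf.aestronglyMeasurable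
  refine (ENNReal.rpow_le_rpow h1 (by norm_num)).trans (le_of_eq ?_)
  rw [eLpNorm_eq_lintegral_rpow_enorm_toReal (by norm_num) (by norm_num), ENNReal.toReal_ofNat,
    ← ENNReal.rpow_mul]
  norm_num

lemma eLpNorm_integral_le_aux (h : P.Invariant π) {f : X → ℂ} (hf : StronglyMeasurable f) :
    eLpNorm (fun x => ∫ y, f y ∂(P x)) 2 π ≤ eLpNorm f 2 π := by
  rw [eLpNorm_eq_lintegral_rpow_enorm_toReal (by norm_num) (by norm_num),
    eLpNorm_eq_lintegral_rpow_enorm_toReal (by norm_num) (by norm_num), ENNReal.toReal_ofNat,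
    ← lintegral_lintegral_enorm_sq h hf]
  exact ENNReal.rpow_le_rpow (lintegral_mono fun x => enorm_integral_sq_le hf x) (by norm_num)

lemma eLpNorm_integral_le (h : P.Invariant π) {f : X → ℂ} (hf : AEStronglyMeasurable f π) :
    eLpNorm (fun x => ∫ y, f y ∂(P x)) 2 π ≤ eLpNorm f 2 π := by
  rw [eLpNorm_congr_ae (integral_ae_congr h hf.ae_eq_mk), eLpNorm_congr_ae hf.ae_eq_mk]
  exact eLpNorm_integral_le_aux h hf.stronglyMeasurable_mk

lemma memLp_integral (h : P.Invariant π) {f : X → ℂ} (hf : MemLp f 2 π) :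
    MemLp (fun x => ∫ y, f y ∂(P x)) 2 π := by
  refine ⟨?_, (eLpNorm_integral_le h hf.1).trans_lt hf.2⟩
  exact ⟨_, hf.1.stronglyMeasurable_mk.integral_kernel, integral_ae_congr h hf.1.ae_eq_mk⟩

lemma ae_integrable (h : P.Invariant π) {f : X → ℂ} (hf : MemLp f 2 π) :
    ∀ᵐ x ∂π, Integrable f (P x) := by
  have hi : Integrable f (P ∘ₘ π) := by
    rw [h.def]; exact hf.integrable (by norm_num)
  exact ((Measure.integrable_comp_iff hi.1).1 hi).1

/-- The operator `(P f)(x) = ∫ f(y) P(x, dy)` on `L²(π)`, for `π` invariant under `P`. -/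
def l2Operator (P : Kernel X X) [IsMarkovKernel P] (π : Measure X) [IsProbabilityMeasure π]
    (h : P.Invariant π) : Lp ℂ 2 π →L[ℂ] Lp ℂ 2 π :=
  LinearMap.mkContinuous
    { toFun := fun f => (memLp_integral h (Lp.memLp f)).toLp (fun x => ∫ y, f y ∂(P x))
      map_add' := by
        intro f g
        rw [← MemLp.toLp_add, MemLp.toLp_eq_toLp_iff]
        filter_upwards [integral_ae_congr h (Lp.coeFn_add f g), ae_integrable h (Lp.memLp f),
          ae_integrable h (Lp.memLp g)] with x hx hf hg
        rw [hx]
        exact integral_add hf hg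
      map_smul' := by
        intro c f
        rw [RingHom.id_apply, ← MemLp.toLp_const_smul, MemLp.toLp_eq_toLp_iff]
        filter_upwards [integral_ae_congr h (Lp.coeFn_smul c f)] with x hx
        rw [hx]
        exact integral_smul c _ }
    1
    (by
      intro f
      rw [one_mul, LinearMap.coe_mk, AddHom.coe_mk, Lp.norm_toLp, Lp.norm_def]
      exact ENNReal.toReal_mono (Lp.memLp f).2.ne (eLpNorm_integral_le h (Lp.memLp f).1))

lemma l2Operator_apply (h : P.Invariant π) (f : Lp ℂ 2 π) :
    l2Operator P π h f =ᵐ[π] fun x => ∫ y, f y ∂(P x) :=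
  MemLp.coeFn_toLp (memLp_integral h (Lp.memLp f))

end Operator

/-! ### Spectrum and spectral gap -/

/-- The nonzero complex numbers `z` for which `z I - T` has no bounded inverse. -/
def nonzeroSpectrum {E : Type*} [NormedAddCommGroup E] [NormedSpace ℂ E] (T : E →L[ℂ] E) :
    Set ℂ :=
  {z : ℂ | z ≠ 0 ∧ z ∈ spectrum ℂ T}

/-- The spectral projection `(2πi)⁻¹ ∮ (z I - T)⁻¹ dz`, the contour being the circle with centre
`w` and radius `r`. -/
def rieszProjection {E : Type*} [NormedAddCommGroup E] [NormedSpace ℂ E] (T : E →L[ℂ] E)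
    (w : ℂ) (r : ℝ) : E →L[ℂ] E :=
  (2 * (Real.pi : ℂ) * Complex.I)⁻¹ • ∮ z in C(w, r), resolvent T z

/-- `w` is a pole of finite multiplicity: it is an isolated point of the spectrum whose spectral
projection has finite rank. -/
def IsPoleOfFiniteMultiplicity {E : Type*} [NormedAddCommGroup E] [NormedSpace ℂ E]
    (T : E →L[ℂ] E) (w : ℂ) : Prop :=
  ∃ r : ℝ, 0 < r ∧ spectrum ℂ T ∩ Metric.closedBall w r = {w} ∧
    FiniteDimensional ℂ (rieszProjection T w r).range

/-- `T` admits a spectral gap: near and outside the unit circle, the spectrum consists of finitely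
many poles of finite multiplicity. -/
def HasSpectralGap {E : Type*} [NormedAddCommGroup E] [NormedSpace ℂ E] (T : E →L[ℂ] E) : Prop :=
  ∃ ε : ℝ, 0 < ε ∧ (nonzeroSpectrum T ∩ {z : ℂ | 1 - ε ≤ ‖z‖}).Finite ∧
    ∀ z ∈ nonzeroSpectrum T, 1 - ε ≤ ‖z‖ → IsPoleOfFiniteMultiplicity T z

/-- The size `1 - sup {|z| : z ∈ S, z ≠ 1}` of the spectral gap, `S` being the nonzero spectrum
(the supremum of the empty set is `0`). -/
def spectralGap {E : Type*} [NormedAddCommGroup E] [NormedSpace ℂ E] (T : E →L[ℂ] E) : ℝ :=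
  1 - sSup {s : ℝ | ∃ z ∈ nonzeroSpectrum T, z ≠ 1 ∧ s = ‖z‖}

/-! ### Norms of signed measures -/

/-- The total variation norm `sup_A |ν(A)|`. -/
def tvNorm {X : Type*} [MeasurableSpace X] (ν : SignedMeasure X) : ℝ≥0∞ :=
  ⨆ A : {A : Set X // MeasurableSet A}, ‖ν A.1‖ₑ

open Classical in
/-- The `L²(π)`-norm of the density `dν/dπ` if it exists, and `∞` otherwise. -/
def l2Norm {X : Type*} [MeasurableSpace X] (π : Measure X) (ν : SignedMeasure X) : ℝ≥0∞ :=
  if VectorMeasure.AbsolutelyContinuous ν π.toENNRealVectorMeasure then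
    eLpNorm (ν.rnDeriv π) 2 π
  else ∞

end

end MarkovL2

/-!
The constants are the only fixed points of `P` in `L²(π)`: if `P f = f`, then `f(x)` and `f(y)` have
equal second moments, and inner product `‖f‖²`, under `π(dx) P(x, dy)`, so they agree almost surely,
and irreducibility does the rest. As `1` is isolated in the spectrum of the normal operator `P`, the
indicator function of `{1}` is continuous on the spectrum, and the continuous functional calculus
turns it into the orthogonal projection `Q` onto the constants. Hence `Pⁿ - Q` is the calculus of
`z ↦ zⁿ - 1_{z = 1}`, and its norm is at most `(1 - δ₂)ⁿ`. Finally `(μ Pⁿ - π)(A)` is the inner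
product of `d(μ - π)/dπ`, which is orthogonal to the constants, with `(Pⁿ - Q) (1_A - 1/2)`; the
factor `1/2` is the norm of `1_A - 1/2`.
-/

namespace MarkovL2

section Isolated

variable {X Y : Type*} [TopologicalSpace X] [T1Space X] [TopologicalSpace Y] {t : Set X} {w : X}

lemma continuousOn_insert_of_isClosed (ht : IsClosed t) {f : X → Y} (hf : ContinuousOn f t) :
    ContinuousOn f (insert w t) :=
  (continuousOn_singleton f w).union_of_isClosed hf isClosed_singleton ht

lemma continuousOn_indicator_singleton [Zero Y] (ht : IsClosed t) (hw : w ∉ t) (f : X → Y) :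
    ContinuousOn (Set.indicator {w} f) (insert w t) :=
  continuousOn_insert_of_isClosed ht <| (continuousOn_const (c := 0)).congr fun _ hz =>
    Set.indicator_of_notMem (Set.notMem_singleton_iff.2 (ne_of_mem_of_not_mem hz hw)) f

end Isolated

section SpectralProjection

variable {A : Type*} [CStarAlgebra A] {a q : A} [IsStarNormal a] {w : ℂ}

lemma cfc_sub_const_id (a : A) [IsStarNormal a] (w : ℂ) :
    cfc (fun z : ℂ => z - w) a = a - algebraMap ℂ A w := by
  rw [cfc_sub (fun z : ℂ => z) (fun _ => w) a, cfc_id' ℂ a, cfc_const w a]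

lemma mul_cfc_indicator_singleton
    (hind : ContinuousOn (Set.indicator {w} (1 : ℂ → ℂ)) (spectrum ℂ a)) :
    a * cfc (Set.indicator {w} (1 : ℂ → ℂ)) a = w • cfc (Set.indicator {w} (1 : ℂ → ℂ)) a := by
  rw [← cfc_const_mul w _ a hind]
  nth_rw 1 [← cfc_id' ℂ a]
  rw [← cfc_mul (fun z => z) (Set.indicator {w} 1) a continuousOn_id hind]
  refine cfc_congr fun z _ => ?_
  by_cases hz : z = w <;> simp [hz]

lemma one_sub_cfc_indicator_singleton
    (hind : ContinuousOn (Set.indicator {w} (1 : ℂ → ℂ)) (spectrum ℂ a))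
    (hinv : ContinuousOn (fun z : ℂ => (z - w)⁻¹) (spectrum ℂ a)) :
    1 - cfc (Set.indicator {w} (1 : ℂ → ℂ)) a =
      cfc (fun z : ℂ => (z - w)⁻¹) a * (a - algebraMap ℂ A w) := by
  rw [← cfc_sub_const_id, ← cfc_const_one ℂ a,
    ← cfc_sub (fun _ => 1) (Set.indicator {w} 1) a continuousOn_const hind,
    ← cfc_mul (fun z => (z - w)⁻¹) (fun z => z - w) a hinv
      (continuousOn_id.sub continuousOn_const)]
  -- As `0⁻¹ = 0`, the product `(z - w)⁻¹ * (z - w)` is `0` at `w`, and it is `1` elsewhere.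
  refine cfc_congr fun z _ => ?_
  by_cases hz : z = w <;> simp [hz, sub_ne_zero]

lemma isSelfAdjoint_cfc_indicator (a : A) (s : Set ℂ) :
    IsSelfAdjoint (cfc (Set.indicator s (1 : ℂ → ℂ)) a) := by
  rw [isSelfAdjoint_iff, ← cfc_star]
  congr 1
  funext z
  by_cases hz : z ∈ s <;> simp [hz]

lemma cfc_indicator_singleton_eq {t : Set ℂ} (ht : IsClosed t) (hw : w ∉ t)
    (hσ : spectrum ℂ a ⊆ insert w t) (hq : IsSelfAdjoint q) (haq : a * q = w • q)
    (hmax : ∀ b, a * b = w • b → q * b = b) :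
    cfc (Set.indicator {w} (1 : ℂ → ℂ)) a = q := by
  have hind := (continuousOn_indicator_singleton ht hw (1 : ℂ → ℂ)).mono hσ
  have hinv : ContinuousOn (fun z : ℂ => (z - w)⁻¹) (spectrum ℂ a) :=
    (continuousOn_insert_of_isClosed ht <| (continuousOn_id.sub continuousOn_const).inv₀
      fun _ hz => sub_ne_zero.2 (ne_of_mem_of_not_mem hz hw)).mono hσ
  set e := cfc (Set.indicator {w} (1 : ℂ → ℂ)) a
  have he : star e = e := isSelfAdjoint_cfc_indicator a {w}
  have heq : e * q = q := by
    have : (1 - e) * q = 0 := by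
      rw [one_sub_cfc_indicator_singleton hind hinv, mul_assoc, sub_mul, haq,
        ← Algebra.smul_def, sub_self, mul_zero]
    rwa [sub_mul, one_mul, sub_eq_zero, eq_comm] at this
  calc e = star (q * e) := by rw [hmax e (mul_cfc_indicator_singleton hind), he]
    _ = q := by rw [star_mul, he, hq.star_eq, heq]

theorem norm_pow_sub_smul_le {ρ : ℝ} (hρ : 0 ≤ ρ) (hρw : ρ < ‖w‖)
    (hσ : ∀ z ∈ spectrum ℂ a, z ≠ w → ‖z‖ ≤ ρ) (hq : IsSelfAdjoint q) (haq : a * q = w • q)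
    (hmax : ∀ b, a * b = w • b → q * b = b) (n : ℕ) :
    ‖a ^ n - w ^ n • q‖ ≤ ρ ^ n := by
  have hw : w ∉ Metric.closedBall (0 : ℂ) ρ := by simpa using hρw
  have hσ' : spectrum ℂ a ⊆ insert w (Metric.closedBall 0 ρ) := fun z hz =>
    or_iff_not_imp_left.2 fun hzw => mem_closedBall_zero_iff.2 (hσ z hz hzw)
  have hind := (continuousOn_indicator_singleton Metric.isClosed_closedBall hw (1 : ℂ → ℂ)).mono hσ'
  rw [← cfc_indicator_singleton_eq Metric.isClosed_closedBall hw hσ' hq haq hmax,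
    ← cfc_const_mul (w ^ n) _ a, ← cfc_pow_id (R := ℂ) a n,
    ← cfc_sub (fun z => z ^ n) (fun z => w ^ n * Set.indicator {w} 1 z) a (continuousOn_pow n)
      (continuousOn_const.mul hind)]
  refine norm_cfc_le (by positivity) fun z hz => ?_
  by_cases hzw : z = w
  · simpa [hzw] using pow_nonneg hρ n
  · simpa [hzw] using pow_le_pow_left₀ (norm_nonneg z) (hσ z hz hzw) n

end SpectralProjection

section SpectralGap

lemma one_sub_spectralGap_nonneg {E : Type*} [NormedAddCommGroup E] [NormedSpace ℂ E]
    (T : E →L[ℂ] E) : 0 ≤ 1 - spectralGap T := by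
  rw [spectralGap, sub_sub_cancel]
  exact Real.sSup_nonneg fun s ⟨z, _, _, hs⟩ => hs ▸ norm_nonneg z

lemma norm_le_one_sub_spectralGap {E : Type*} [NormedAddCommGroup E] [NormedSpace ℂ E]
    [CompleteSpace E] (T : E →L[ℂ] E) {z : ℂ} (hz : z ∈ spectrum ℂ T) (hz1 : z ≠ 1) :
    ‖z‖ ≤ 1 - spectralGap T := by
  rcases eq_or_ne z 0 with rfl | hz0
  · simpa using one_sub_spectralGap_nonneg T
  · rw [spectralGap, sub_sub_cancel]
    refine le_csSup ⟨‖T‖ * ‖(1 : E →L[ℂ] E)‖, ?_⟩ ⟨z, ⟨hz0, hz⟩, hz1, rfl⟩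
    rintro s ⟨w, hw, -, rfl⟩
    exact spectrum.norm_le_norm_mul_of_mem hw.2

open InnerProductSpace (rankOne)

variable {H : Type*} [NormedAddCommGroup H] [InnerProductSpace ℂ H] [CompleteSpace H]
  {T : H →L[ℂ] H} {e : H}

lemma norm_pow_sub_rankOne_le_one (hT : ‖T‖ ≤ 1) (he : ‖e‖ = 1) (hTe : T e = e) (n : ℕ) :
    ‖T ^ n - rankOne ℂ e e‖ ≤ 1 := by
  have hTn : T ^ n * rankOne ℂ e e = rankOne ℂ e e := by
    induction n with
    | zero => simp
    | succ n ih =>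
      rw [pow_succ, mul_assoc, ContinuousLinearMap.mul_def T, InnerProductSpace.comp_rankOne,
        hTe, ih]
  have : Nontrivial H := ⟨e, 0, by rintro rfl; simp at he⟩
  calc ‖T ^ n - rankOne ℂ e e‖ = ‖T ^ n * (1 - rankOne ℂ e e)‖ := by
        rw [mul_sub, mul_one, hTn]
    _ ≤ ‖T ^ n‖ * ‖1 - rankOne ℂ e e‖ := norm_mul_le _ _
    _ ≤ 1 := mul_le_one₀ ((norm_pow_le T n).trans (pow_le_one₀ (norm_nonneg T) hT))
        (norm_nonneg _)
        (IsStarProjection.norm_le _ (InnerProductSpace.isStarProjection_rankOne_self he).one_sub)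

variable [IsStarNormal T]

theorem norm_pow_sub_rankOne_le (hT : ‖T‖ ≤ 1) (he : ‖e‖ = 1) (hTe : T e = e)
    (hfix : ∀ f, T f = f → ∃ c : ℂ, f = c • e) (n : ℕ) :
    ‖T ^ n - rankOne ℂ e e‖ ≤ (1 - spectralGap T) ^ n := by
  rcases le_or_gt (spectralGap T) 0 with hgap | hgap
  · exact (norm_pow_sub_rankOne_le_one hT he hTe n).trans (one_le_pow₀ (by linarith))
  have hTQ : T * rankOne ℂ e e = (1 : ℂ) • rankOne ℂ e e := by
    rw [ContinuousLinearMap.mul_def, InnerProductSpace.comp_rankOne, hTe, one_smul]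
  have hmax (S : H →L[ℂ] H) (hS : T * S = (1 : ℂ) • S) : rankOne ℂ e e * S = S := by
    ext f
    obtain ⟨c, hc⟩ := hfix (S f) (by simpa using DFunLike.congr_fun hS f)
    simp [hc, he]
  simpa using norm_pow_sub_smul_le (one_sub_spectralGap_nonneg T) (by simpa using hgap)
    (fun _ => norm_le_one_sub_spectralGap T)
    (InnerProductSpace.isStarProjection_rankOne_self he).isSelfAdjoint hTQ hmax n

theorem norm_inner_pow_apply_le (hT : ‖T‖ ≤ 1) (he : ‖e‖ = 1) (hTe : T e = e)
    (hfix : ∀ f, T f = f → ∃ c : ℂ, f = c • e) {g : H} (hg : inner ℂ g e = 0) (f : H) (c : ℂ)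
    (n : ℕ) :
    ‖inner ℂ g ((T ^ n) f)‖ ≤ ‖g‖ * ((1 - spectralGap T) ^ n * ‖f - c • e‖) := by
  have hTne : (T ^ n) e = e := by
    rw [FunLike.coe_pow_eq_iterate]
    exact Function.iterate_fixed hTe n
  have hinner : inner ℂ g ((T ^ n) f) = inner ℂ g ((T ^ n - rankOne ℂ e e) (f - c • e)) := by
    rw [map_sub, map_smul, sub_apply, sub_apply, hTne]
    simp [hg, he]
  rw [hinner]
  refine (norm_inner_le_norm _ _).trans ?_
  gcongr
  exact ContinuousLinearMap.le_of_opNorm_le _ (norm_pow_sub_rankOne_le hT he hTe hfix n) _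

end SpectralGap

section Transition

variable {X : Type*} [MeasurableSpace X] {K L : Kernel X X} {π : Measure X}

lemma invariant_pow (h : K.Invariant π) (n : ℕ) : (K ^ n).Invariant π := by
  induction n with
  | zero => rw [pow_zero]; exact Measure.id_comp
  | succ n ih => rw [pow_succ]; exact ih.comp h

variable [IsMarkovKernel K] [IsMarkovKernel L] [IsProbabilityMeasure π]

lemma l2Operator_mul (hK : K.Invariant π) (hL : L.Invariant π) :
    l2Operator K π hK * l2Operator L π hL = l2Operator (L ∘ₖ K) π (hL.comp hK) := by
  ext f
  filter_upwards [l2Operator_apply hK (l2Operator L π hL f), integral_ae_congr hK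
    (l2Operator_apply hL f), l2Operator_apply (hL.comp hK) f, ae_integrable (hL.comp hK)
    (Lp.memLp f)] with x hx hx' hcomp hint
  rw [mul_apply_eq_comp, hx, hx', hcomp, Kernel.integral_comp hint]

lemma l2Operator_pow (h : K.Invariant π) (n : ℕ) :
    l2Operator K π h ^ n = l2Operator (K ^ n) π (invariant_pow h n) := by
  induction n with
  | zero =>
    ext f
    filter_upwards [l2Operator_apply (invariant_pow h 0) f] with x hx
    rw [hx, pow_zero, pow_zero]
    exact (integral_dirac' _ x (Lp.stronglyMeasurable f)).symm
  | succ n ih =>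
    rw [pow_succ', ih, l2Operator_mul]
    rfl

lemma norm_l2Operator_le_one (h : K.Invariant π) : ‖l2Operator K π h‖ ≤ 1 :=
  LinearMap.mkContinuous_norm_le _ zero_le_one _

lemma l2Operator_const (h : K.Invariant π) (c : ℂ) :
    l2Operator K π h (Lp.const 2 π c) = Lp.const 2 π c := by
  ext1
  filter_upwards [l2Operator_apply h (Lp.const 2 π c), integral_ae_congr h (Lp.coeFn_const 2 π c),
    Lp.coeFn_const 2 π c] with x hx hx' hc
  rw [hx, hx', hc]
  simp

lemma l2Operator_indicatorConstLp (h : K.Invariant π) {A : Set X} (hA : MeasurableSet A) (c : ℂ) :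
    l2Operator K π h (indicatorConstLp 2 hA (measure_ne_top π A) c) =ᵐ[π]
      fun x => (K x).real A • c := by
  filter_upwards [l2Operator_apply h _, integral_ae_congr h (indicatorConstLp_coeFn (p := 2)
    (hs := hA) (hμs := measure_ne_top π A) (c := c))] with x hx hx'
  rw [hx, hx', integral_indicator_const c hA]

end Transition

section TwoStep

variable {X : Type*} [MeasurableSpace X] {K : Kernel X X} {π : Measure X}

lemma measurePreserving_fst_compProd [SFinite π] [IsMarkovKernel K] :
    MeasurePreserving Prod.fst (π ⊗ₘ K) π :=
  ⟨measurable_fst, Measure.fst_compProd π K⟩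

lemma measurePreserving_snd_compProd [SFinite π] [IsSFiniteKernel K] (h : K.Invariant π) :
    MeasurePreserving Prod.snd (π ⊗ₘ K) π :=
  ⟨measurable_snd, (Measure.snd_compProd π K).trans h.def⟩

lemma measurePreserving_swap_compProd [IsFiniteMeasure π] [IsFiniteKernel K]
    (h : K.IsReversible π) :
    MeasurePreserving Prod.swap (π ⊗ₘ K) (π ⊗ₘ K) := by
  refine ⟨measurable_swap, Measure.ext_prod fun {s t} hs ht => ?_⟩
  rw [Measure.map_apply measurable_swap (hs.prod ht), Set.preimage_swap_prod,
    Measure.compProd_apply_prod ht hs, Measure.compProd_apply_prod hs ht, h ht hs]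

variable [IsMarkovKernel K]

/-- The isometric embedding `f ↦ f ∘ Prod.fst` of `L²(π)` into the `L²` space of `π ⊗ₘ K`, the law
of the first two states of a chain with initial law `π` and transition kernel `K`. -/
noncomputable abbrev l2Fst (K : Kernel X X) [IsMarkovKernel K] (π : Measure X) [SFinite π] :
    Lp ℂ 2 π →ₗᵢ[ℂ] Lp ℂ 2 (π ⊗ₘ K) :=
  Lp.compMeasurePreservingₗᵢ ℂ Prod.fst measurePreserving_fst_compProd

/-- The isometric embedding `f ↦ f ∘ Prod.snd` of `L²(π)` into the `L²` space of `π ⊗ₘ K`, for `π`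
invariant under `K`. -/
noncomputable abbrev l2Snd [SFinite π] (h : K.Invariant π) :
    Lp ℂ 2 π →ₗᵢ[ℂ] Lp ℂ 2 (π ⊗ₘ K) :=
  Lp.compMeasurePreservingₗᵢ ℂ Prod.snd (measurePreserving_snd_compProd h)

lemma coeFn_l2Fst [SFinite π] (f : Lp ℂ 2 π) : l2Fst K π f =ᵐ[π ⊗ₘ K] fun p => f p.1 :=
  Lp.coeFn_compMeasurePreserving f measurePreserving_fst_compProd

lemma coeFn_l2Snd [SFinite π] (h : K.Invariant π) (f : Lp ℂ 2 π) :
    l2Snd h f =ᵐ[π ⊗ₘ K] fun p => f p.2 :=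
  Lp.coeFn_compMeasurePreserving f (measurePreserving_snd_compProd h)

variable [IsProbabilityMeasure π]

lemma inner_l2Operator (h : K.Invariant π) (f g : Lp ℂ 2 π) :
    inner ℂ f (l2Operator K π h g) = inner ℂ (l2Fst K π f) (l2Snd h g) := by
  have hfg : (fun p : X × X => inner ℂ (l2Fst K π f p) (l2Snd h g p)) =ᵐ[π ⊗ₘ K]
      fun p => inner ℂ (f p.1) (g p.2) := by
    filter_upwards [coeFn_l2Fst f, coeFn_l2Snd h g] with p hf hg
    rw [hf, hg]
  rw [L2.inner_def, L2.inner_def, integral_congr_ae hfg,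
    Measure.integral_compProd ((L2.integrable_inner _ _).congr hfg)]
  refine integral_congr_ae ?_
  filter_upwards [l2Operator_apply h g] with x hx
  simp only [hx, RCLike.inner_apply', integral_const_mul]

lemma isSelfAdjoint_l2Operator (h : K.IsReversible π) :
    IsSelfAdjoint (l2Operator K π h.invariant) := by
  have hswap := measurePreserving_swap_compProd h
  let swap := Lp.compMeasurePreservingₗᵢ ℂ (E := ℂ) (p := 2) Prod.swap hswap
  have h_fst (f : Lp ℂ 2 π) : swap (l2Fst K π f) = l2Snd h.invariant f :=
    (Lp.compMeasurePreserving_comp_apply f measurePreserving_fst_compProd hswap).symm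
  have h_snd (f : Lp ℂ 2 π) : swap (l2Snd h.invariant f) = l2Fst K π f :=
    (Lp.compMeasurePreserving_comp_apply f (measurePreserving_snd_compProd h.invariant)
      hswap).symm
  rw [ContinuousLinearMap.isSelfAdjoint_iff_isSymmetric]
  intro f g
  calc inner ℂ (l2Operator K π h.invariant f) g
      = inner ℂ (l2Snd h.invariant f) (l2Fst K π g) := by
        rw [← inner_conj_symm, inner_l2Operator, inner_conj_symm]
    _ = inner ℂ (swap (l2Fst K π f)) (swap (l2Snd h.invariant g)) := by rw [h_fst, h_snd]
    _ = inner ℂ f (l2Operator K π h.invariant g) := by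
        rw [LinearIsometry.inner_map_map, inner_l2Operator]

lemma ae_ae_eq_of_l2Operator_eq_self (h : K.Invariant π) {f : Lp ℂ 2 π}
    (hf : l2Operator K π h f = f) : ∀ᵐ x ∂π, ∀ᵐ y ∂(K x), f y = f x := by
  -- A fixed point attains equality in the Cauchy–Schwarz inequality for `f ∘ fst` and `f ∘ snd`.
  have heq : l2Fst K π f = l2Snd h f := by
    refine eq_of_norm_le_re_inner_eq_norm_sq (𝕜 := ℂ) ?_ ?_
    · rw [LinearIsometry.norm_map, LinearIsometry.norm_map]
    · rw [← inner_l2Operator, hf, LinearIsometry.norm_map, inner_self_eq_norm_sq]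
  refine Measure.ae_ae_of_ae_compProd (p := fun p : X × X => f p.2 = f p.1) ?_
  filter_upwards [coeFn_l2Fst (K := K) f, coeFn_l2Snd h f] with p h_fst h_snd
  rw [← h_fst, ← h_snd, heq]

end TwoStep

section Irreducible

variable {X : Type*} [MeasurableSpace X] {K : Kernel X X} [IsMarkovKernel K] {π φ : Measure X}
  [IsProbabilityMeasure π]

lemma exists_eq_smul_const_of_l2Operator_eq_self [NeZero φ] [Kernel.IsIrreducible φ K]
    (h : K.Invariant π) {f : Lp ℂ 2 π} (hf : l2Operator K π h f = f) :
    ∃ c : ℂ, f = c • Lp.const 2 π (1 : ℂ) := by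
  have hpow : ∀ᵐ x ∂π, ∀ n : ℕ, ∀ᵐ y ∂((K ^ n) x), f y = f x := by
    refine ae_all_iff.2 fun n => ae_ae_eq_of_l2Operator_eq_self (invariant_pow h n) ?_
    rw [← l2Operator_pow h, FunLike.coe_pow_eq_iterate, Function.iterate_fixed hf]
  have hφ (x : X) (hx : ∀ n : ℕ, ∀ᵐ y ∂((K ^ n) x), f y = f x) : ∀ᵐ y ∂φ, f y = f x := by
    by_contra hne
    obtain ⟨n, hn⟩ := Kernel.IsIrreducible.irreducible (φ := φ) (κ := K)
      ((Lp.stronglyMeasurable f).measurable (measurableSet_singleton (f x))).compl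
      (pos_iff_ne_zero.2 hne) x
    exact hn.ne' (hx n)
  have : (ae φ).NeBot := ae_neBot.2 (NeZero.ne φ)
  obtain ⟨x₀, hx₀⟩ := hpow.exists
  refine ⟨f x₀, ?_⟩
  ext1
  filter_upwards [hpow, Lp.coeFn_smul (f x₀) (Lp.const 2 π (1 : ℂ)),
    Lp.coeFn_const 2 π (1 : ℂ)] with x hx hsmul hone
  obtain ⟨y, hyx, hyx₀⟩ := ((hφ x hx).and (hφ x₀ hx₀)).exists
  rw [hsmul, Pi.smul_apply, hone, Function.const_apply, smul_eq_mul, mul_one, ← hyx, hyx₀]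

end Irreducible

section Real

variable {X : Type*} [MeasurableSpace X] {π : Measure X} {g : X → ℝ}

/-- A real square-integrable function, as an element of the complex space `L²(π)`. -/
noncomputable def l2OfReal (hg : MemLp g 2 π) : Lp ℂ 2 π :=
  (hg.ofReal (K := ℂ)).toLp fun x => (g x : ℂ)

lemma coeFn_l2OfReal (hg : MemLp g 2 π) : l2OfReal hg =ᵐ[π] fun x => (g x : ℂ) :=
  MemLp.coeFn_toLp _

lemma norm_l2OfReal (hg : MemLp g 2 π) : ‖l2OfReal hg‖ = (eLpNorm g 2 π).toReal := by
  rw [Lp.norm_def, eLpNorm_congr_ae (coeFn_l2OfReal hg)]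
  exact congrArg _ (eLpNorm_congr_norm_ae (ae_of_all _ fun x => Complex.norm_real (g x)))

lemma inner_l2OfReal_const_one [IsFiniteMeasure π] (hg : MemLp g 2 π) :
    inner ℂ (l2OfReal hg) (Lp.const 2 π 1) = ((∫ x, g x ∂π : ℝ) : ℂ) := by
  rw [L2.inner_def, ← integral_complex_ofReal]
  refine integral_congr_ae ?_
  filter_upwards [coeFn_l2OfReal hg, Lp.coeFn_const 2 π (1 : ℂ)] with x hx hone
  rw [hx, hone]
  simp

variable [IsProbabilityMeasure π]

lemma inner_l2OfReal_l2Operator_indicatorConstLp {K : Kernel X X} [IsMarkovKernel K]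
    (h : K.Invariant π) (hg : MemLp g 2 π) {A : Set X} (hA : MeasurableSet A) :
    inner ℂ (l2OfReal hg) (l2Operator K π h (indicatorConstLp 2 hA (measure_ne_top π A) 1)) =
      ((∫ x, g x * (K x).real A ∂π : ℝ) : ℂ) := by
  rw [L2.inner_def, ← integral_complex_ofReal]
  refine integral_congr_ae ?_
  filter_upwards [coeFn_l2OfReal hg, l2Operator_indicatorConstLp h hA 1] with x hx hKx
  rw [hx, hKx]
  simp [mul_comm]

lemma norm_indicatorConstLp_sub_half_le {A : Set X} (hA : MeasurableSet A) :
    ‖indicatorConstLp 2 hA (measure_ne_top π A) (1 : ℂ) - (1 / 2 : ℂ) • Lp.const 2 π 1‖ ≤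
      1 / 2 := by
  refine (Lp.norm_le_of_ae_bound (C := 1 / 2) (by norm_num) ?_).trans_eq
    (by simp [measureUnivNNReal])
  filter_upwards [Lp.coeFn_sub (indicatorConstLp 2 hA (measure_ne_top π A) (1 : ℂ))
    ((1 / 2 : ℂ) • Lp.const 2 π 1), Lp.coeFn_smul (1 / 2 : ℂ) (Lp.const 2 π (1 : ℂ)),
    Lp.coeFn_const 2 π (1 : ℂ), indicatorConstLp_coeFn (p := 2) (hs := hA)
    (hμs := measure_ne_top π A) (c := (1 : ℂ))] with x hsub hsmul hone hind
  rw [hsub, Pi.sub_apply, hsmul, Pi.smul_apply, hone, hind]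
  by_cases hx : x ∈ A <;> norm_num [hx]

theorem abs_integral_mul_pow_measureReal_le {P : Kernel X X} [IsMarkovKernel P]
    (h : P.Invariant π) [IsStarNormal (l2Operator P π h)] {φ : Measure X} [NeZero φ]
    [Kernel.IsIrreducible φ P] (hg : MemLp g 2 π) (hg0 : ∫ x, g x ∂π = 0) {A : Set X}
    (hA : MeasurableSet A) (n : ℕ) :
    |∫ x, g x * ((P ^ n) x).real A ∂π| ≤
      1 / 2 * (eLpNorm g 2 π).toReal * (1 - spectralGap (l2Operator P π h)) ^ n := by
  have hone : ‖Lp.const 2 π (1 : ℂ)‖ = 1 := by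
    simp [Lp.norm_const]
  have hortho : inner ℂ (l2OfReal hg) (Lp.const 2 π 1) = 0 := by
    rw [inner_l2OfReal_const_one, hg0, Complex.ofReal_zero]
  calc |∫ x, g x * ((P ^ n) x).real A ∂π|
      = ‖inner ℂ (l2OfReal hg) ((l2Operator P π h ^ n)
          (indicatorConstLp 2 hA (measure_ne_top π A) 1))‖ := by
        rw [l2Operator_pow, inner_l2OfReal_l2Operator_indicatorConstLp, Complex.norm_real,
          Real.norm_eq_abs]
    _ ≤ (eLpNorm g 2 π).toReal * ((1 - spectralGap (l2Operator P π h)) ^ n * (1 / 2)) := by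
        rw [← norm_l2OfReal hg]
        refine (norm_inner_pow_apply_le (norm_l2Operator_le_one h) hone (l2Operator_const h 1)
          (fun f => exists_eq_smul_const_of_l2Operator_eq_self (φ := φ) h) hortho _ (1 / 2)
          n).trans ?_
        gcongr
        · exact pow_nonneg (one_sub_spectralGap_nonneg _) n
        · exact norm_indicatorConstLp_sub_half_le hA
    _ = _ := by ring

end Real

section SignedMeasure

variable {X : Type*} [MeasurableSpace X] {μ π : Measure X}

lemma l2Norm_eq_eLpNorm {ν : SignedMeasure X} (h : l2Norm π ν ≠ ∞) :
    l2Norm π ν = eLpNorm (ν.rnDeriv π) 2 π :=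
  if_pos (not_imp_comm.1 (fun hac => if_neg hac) h)

lemma memLp_rnDeriv_of_l2Norm_ne_top {ν : SignedMeasure X} (h : l2Norm π ν ≠ ∞) :
    MemLp (ν.rnDeriv π) 2 π :=
  ⟨(SignedMeasure.integrable_rnDeriv ν π).1, by rwa [← l2Norm_eq_eLpNorm h, lt_top_iff_ne_top]⟩

lemma measureReal_bind {Y : Type*} [MeasurableSpace Y] {K : Kernel X Y} [IsFiniteKernel K]
    {A : Set Y} (hA : MeasurableSet A) : (μ.bind K).real A = ∫ x, (K x).real A ∂μ := by
  simp_rw [measureReal_def]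
  rw [Measure.bind_apply hA K.aemeasurable,
    integral_toReal (K.measurable_coe hA).aemeasurable (ae_of_all _ fun x => measure_lt_top _ _)]

variable [IsFiniteMeasure μ] [IsFiniteMeasure π]

lemma absolutelyContinuous_of_toSignedMeasure_sub
    (h : VectorMeasure.AbsolutelyContinuous (μ.toSignedMeasure - π.toSignedMeasure)
      π.toENNRealVectorMeasure) : μ ≪ π := by
  refine Measure.AbsolutelyContinuous.mk fun s hs hπs => ?_
  have hsub := h (s := s) (by rwa [Measure.toENNRealVectorMeasure_apply_measurable hs])
  rwa [Measure.toSignedMeasure_sub_apply hs, (measureReal_eq_zero_iff).2 hπs, sub_zero,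
    measureReal_eq_zero_iff] at hsub

lemma rnDeriv_toSignedMeasure_sub (h : μ ≪ π) :
    (μ.toSignedMeasure - π.toSignedMeasure).rnDeriv π =ᵐ[π]
      fun x => (μ.rnDeriv π x).toReal - 1 := by
  have hμ : Integrable (fun x => (μ.rnDeriv π x).toReal) π := Measure.integrable_toReal_rnDeriv
  have hsub := hμ.sub (integrable_const (1 : ℝ))
  refine (SignedMeasure.eq_rnDeriv 0 _ hsub VectorMeasure.MutuallySingular.zero_left ?_).symm
  ext s hs
  rw [zero_add, withDensityᵥ_apply hsub hs, Measure.toSignedMeasure_sub_apply hs]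
  simp only [Pi.sub_apply]
  rw [integral_sub hμ.integrableOn (integrable_const 1).integrableOn,
    Measure.setIntegral_toReal_rnDeriv h]
  simp

lemma integral_rnDeriv_toSignedMeasure_sub_mul (h : μ ≪ π) {u : X → ℝ} (hμ : Integrable u μ)
    (hπ : Integrable u π) :
    ∫ x, (μ.toSignedMeasure - π.toSignedMeasure).rnDeriv π x * u x ∂π =
      ∫ x, u x ∂μ - ∫ x, u x ∂π := by
  rw [← integral_toReal_rnDeriv_mul h,
    ← integral_sub ((integrable_toReal_rnDeriv_mul_iff h).2 hμ) hπ]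
  refine integral_congr_ae ?_
  filter_upwards [rnDeriv_toSignedMeasure_sub h] with x hx
  rw [hx, sub_mul, one_mul]

lemma toSignedMeasure_bind_sub_apply (h : μ ≪ π) {K : Kernel X X} [IsFiniteKernel K]
    (hK : K.Invariant π) {A : Set X} (hA : MeasurableSet A) :
    ((μ.bind K).toSignedMeasure - π.toSignedMeasure) A =
      ∫ x, (μ.toSignedMeasure - π.toSignedMeasure).rnDeriv π x * (K x).real A ∂π := by
  rw [integral_rnDeriv_toSignedMeasure_sub_mul h (Kernel.IsFiniteKernel.integrable _ K hA)
    (Kernel.IsFiniteKernel.integrable _ K hA), ← measureReal_bind hA, ← measureReal_bind hA, hK.def,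
    Measure.toSignedMeasure_sub_apply hA]

lemma absolutelyContinuous_of_l2Norm_ne_top
    (h : l2Norm π (μ.toSignedMeasure - π.toSignedMeasure) ≠ ∞) : μ ≪ π :=
  absolutelyContinuous_of_toSignedMeasure_sub (not_imp_comm.1 (fun hac => if_neg hac) h)

end SignedMeasure

lemma enorm_toSignedMeasure_bind_pow_sub_apply_le {X : Type*} [MeasurableSpace X]
    {P : Kernel X X} [IsMarkovKernel P] {π φ μ : Measure X} [IsProbabilityMeasure π]
    [IsProbabilityMeasure μ] [NeZero φ] [Kernel.IsIrreducible φ P] (hinv : P.Invariant π)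
    [IsStarNormal (l2Operator P π hinv)]
    (hμ : l2Norm π (μ.toSignedMeasure - π.toSignedMeasure) ≠ ∞) (n : ℕ) {A : Set X}
    (hA : MeasurableSet A) :
    ‖((μ.bind (P ^ n)).toSignedMeasure - π.toSignedMeasure) A‖ₑ ≤
      1 / 2 * l2Norm π (μ.toSignedMeasure - π.toSignedMeasure) *
        ENNReal.ofReal (1 - spectralGap (l2Operator P π hinv)) ^ n := by
  have hac := absolutelyContinuous_of_l2Norm_ne_top hμ
  have hg := memLp_rnDeriv_of_l2Norm_ne_top hμ
  have hg0 : ∫ x, (μ.toSignedMeasure - π.toSignedMeasure).rnDeriv π x ∂π = 0 := by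
    simpa using integral_rnDeriv_toSignedMeasure_sub_mul hac
      (integrable_const (1 : ℝ)) (integrable_const (1 : ℝ))
  have hle := abs_integral_mul_pow_measureReal_le (φ := φ) hinv hg hg0 hA n
  rw [toSignedMeasure_bind_sub_apply hac (invariant_pow hinv n) hA, Real.enorm_eq_ofReal_abs,
    l2Norm_eq_eLpNorm hμ]
  refine (ENNReal.ofReal_le_ofReal hle).trans_eq ?_
  rw [ENNReal.ofReal_mul (by positivity), ENNReal.ofReal_mul (by norm_num),
    ENNReal.ofReal_toReal hg.2.ne, ENNReal.ofReal_pow (one_sub_spectralGap_nonneg _), one_div,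
    one_div, ENNReal.ofReal_inv_of_pos two_pos, ENNReal.ofReal_ofNat]

end MarkovL2

theorem proposition3_general {X : Type*} [MeasurableSpace X] (P : Kernel X X) [IsMarkovKernel P]
    (π : Measure X) [IsProbabilityMeasure π] (hinv : P.Invariant π)
    [IsStarNormal (MarkovL2.l2Operator P π hinv)]
    (φ : Measure X) [NeZero φ] [Kernel.IsIrreducible φ P]
    (μ : Measure X) [IsProbabilityMeasure μ]
    (hμ : MarkovL2.l2Norm π (μ.toSignedMeasure - π.toSignedMeasure) ≠ ∞ ∨
      MarkovL2.spectralGap (MarkovL2.l2Operator P π hinv) < 1)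
    (n : ℕ) :
    MarkovL2.tvNorm ((μ.bind (P ^ n)).toSignedMeasure - π.toSignedMeasure) ≤
      1 / 2 * MarkovL2.l2Norm π (μ.toSignedMeasure - π.toSignedMeasure) *
        ENNReal.ofReal (1 - MarkovL2.spectralGap (MarkovL2.l2Operator P π hinv)) ^ n := by
  by_cases hfin : MarkovL2.l2Norm π (μ.toSignedMeasure - π.toSignedMeasure) = ∞
  · have hpos := ENNReal.ofReal_pos.2 (sub_pos.2 (hμ.resolve_left (not_not_intro hfin)))
    rw [hfin, ENNReal.mul_top (by norm_num), ENNReal.top_mul (pow_ne_zero n hpos.ne')]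
    exact le_top
  · exact iSup_le fun A =>
      MarkovL2.enorm_toSignedMeasure_bind_pow_sub_apply_le (φ := φ) hinv hfin n A.2

theorem proposition3 {X : Type*} [MeasurableSpace X] [MeasurableSpace.CountablyGenerated X]
    (P : ProbabilityTheory.Kernel X X) [ProbabilityTheory.IsMarkovKernel P]
    (π : MeasureTheory.Measure X) [MeasureTheory.IsProbabilityMeasure π]
    (hrev : P.IsReversible π)
    (ψ : MeasureTheory.Measure X) (hψ : MarkovL2.IsPsiIrreducibleAperiodic P ψ)
    (hgap : MarkovL2.HasSpectralGap (MarkovL2.l2Operator P π hrev.invariant))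
    (hδ : 0 < MarkovL2.spectralGap (MarkovL2.l2Operator P π hrev.invariant))
    (μ : MeasureTheory.Measure X) [MeasureTheory.IsProbabilityMeasure μ]
    -- excludes only the indeterminate right-hand side `∞ * 0`
    (hμ : MarkovL2.l2Norm π (μ.toSignedMeasure - π.toSignedMeasure) ≠ ∞ ∨
      MarkovL2.spectralGap (MarkovL2.l2Operator P π hrev.invariant) < 1)
    (n : ℕ) (hn : 1 ≤ n) :
    MarkovL2.tvNorm ((μ.bind (P ^ n)).toSignedMeasure - π.toSignedMeasure) ≤
      1 / 2 * MarkovL2.l2Norm π (μ.toSignedMeasure - π.toSignedMeasure) *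
        ENNReal.ofReal
          (1 - MarkovL2.spectralGap (MarkovL2.l2Operator P π hrev.invariant)) ^ n := by
  have : NeZero ψ := ⟨hψ.ne_zero⟩
  have : Kernel.IsIrreducible ψ P := ⟨fun _ hA hψA x => (hψ.charges _ hA hψA x).exists⟩
  have := (MarkovL2.isSelfAdjoint_l2Operator hrev).isStarNormal
  exact proposition3_general P π hrev.invariant ψ μ hμ n
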